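/- Let $\Bbbk$ be an algebraically closed field of characteristic zero. For $f\in\Bbbk[c]$ let $R_f=\Bbbk\langle a,c\mid ac=ca+f\rangle$, and for $f,g\in\Bbbk[c]$ let $P(f,g)$ be the skew polynomial ring $R_f[d;\sigma,\delta]$ with $\sigma(c)=c$, $\delta(c)=f$, $\sigma(a)=a-g$, $\delta(a)=ga$, that is, the $\Bbbk$-algebra generated by $a,c,d$ with the relations $ac=ca+f$, $dc=cd+f$, $da=(a-g)d+ga$. Put $u=d-a$. Let $f\in\Bbbk[c]$ be nonconstant with $f=cg$, $g\in\Bbbk[c]$, and let $P=P(f,g)=P(cg,g)$. For $x\in P$ let $(x)$ be the two-sided ideal of $P$ generated by $x$. Then: 1. The height one prime ideals of $P$ are exactly the ideals $(c-\alpha)$ with $\alpha\in\Bbbk$, $f(\alpha)=0$, and the ideals $(u-\beta c)$ with $\beta\in\Bbbk$ arbitrary. Moreover $(c-\alpha)=(c-\alpha)P$ for these $\alpha$, and $(u-\beta c)=(u-\beta c)P$ for all $\beta\in\Bbbk$. 2. Let $f(\alpha)=0$. If $g(\alpha)=0$, then $P/(c-\alpha)P\cong\Bbbk[a,u]$, the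 commutative polynomial ring in two variables, by an isomorphism of $\Bbbk$-algebras that sends the classes of $a$ and $u$ to the variables $a$ and $u$. If $g(\alpha)\neq0$ (which can happen only for $\alpha=0$), then $P/(c-\alpha)P$ is isomorphic as a $\Bbbk$-algebra to $R_c=\Bbbk\langle a,c\mid ac=ca+c\rangle$, the universal enveloping algebra of the two-dimensional nonabelian Lie algebra, by an isomorphism that sends the class of $a$ to $g(\alpha)a$ and the class of $u$ to $c$. 3. For every $\beta\in\Bbbk$, $P/(u-\beta c)P\cong R_f$, by an isomorphism of $\Bbbk$-algebras that sends the classes of $a$ and $c$ to $a$ and $c$. -/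

import Mathlib

noncomputable section

namespace DiffOp

open Polynomial

/-! ### Prime ideals of a noncommutative ring and their height -/

/-- A two-sided ideal `I` of a (not necessarily commutative) ring `R` is prime if it is proper and
`x R y ⊆ I` implies `x ∈ I` or `y ∈ I`. -/
structure IsPrimeIdeal {R : Type*} [Ring R] (I : TwoSidedIdeal R) : Prop where
  ne_top : I ≠ ⊤
  mem_or_mem : ∀ x y : R, (∀ r : R, x * r * y ∈ I) → x ∈ I ∨ y ∈ I

/-- The prime ideals of `R`, ordered by inclusion. -/
abbrev PrimeIdeals (R : Type*) [Ring R] : Type _ := {I : TwoSidedIdeal R // IsPrimeIdeal I}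

/-- `I` is a prime ideal of height one: the supremum of the lengths `n` of the chains
`I₀ < I₁ < ⋯ < Iₙ = I` of prime ideals is `1`. -/
def IsHeightOnePrime {R : Type*} [Ring R] (I : TwoSidedIdeal R) : Prop :=
  ∃ h : IsPrimeIdeal I, Order.height (⟨I, h⟩ : PrimeIdeals R) = 1

/-- The quotient `R / (x)` of a ring by the two-sided ideal generated by `x`. -/
abbrev QuotBy {R : Type*} [Ring R] (x : R) : Type _ := (TwoSidedIdeal.span {x}).ringCon.Quotient

/-- The residue class of `r` in `R / (x)`. -/
abbrev cls {R : Type*} [Ring R] (x r : R) : QuotBy x := (TwoSidedIdeal.span {x}).ringCon.toQuotient r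

variable {k : Type*} [Field k]

/-! ### The differential operator ring `R_f = k⟨a, c | a c = c a + f(c)⟩` -/

/-- Names of the generators of `R_f`. -/
inductive RGen
  | a
  | c

/-- The defining relation of `R_f`. -/
inductive RRel (f : k[X]) : FreeAlgebra k RGen → FreeAlgebra k RGen → Prop
  | a_c : RRel f (FreeAlgebra.ι k RGen.a * FreeAlgebra.ι k RGen.c)
      (FreeAlgebra.ι k RGen.c * FreeAlgebra.ι k RGen.a + aeval (FreeAlgebra.ι k RGen.c) f)

/-- `R_f = k⟨a, c | a c = c a + f(c)⟩`. -/
def R (f : k[X]) : Type _ := RingQuot (RRel f)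

instance (f : k[X]) : Ring (R f) := inferInstanceAs (Ring (RingQuot (RRel f)))

instance (f : k[X]) : Algebra k (R f) := inferInstanceAs (Algebra k (RingQuot (RRel f)))

/-- The generator `a` of `R_f`. -/
def R.a (f : k[X]) : R f := RingQuot.mkAlgHom k (RRel f) (FreeAlgebra.ι k RGen.a)

/-- The generator `c` of `R_f`. -/
def R.c (f : k[X]) : R f := RingQuot.mkAlgHom k (RRel f) (FreeAlgebra.ι k RGen.c)

/-! ### The algebra `P(f, g)`

This is the iterated skew polynomial ring `R_f[d; σ, δ]` with `σ(c) = c`, `δ(c) = f`,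
`σ(a) = a - g`, `δ(a) = g a`. As `c` and `a` generate `R_f`, the commutation rule
`d r = σ(r) d + δ(r)` amounts to its cases `r = c` and `r = a`. -/

/-- Names of the generators of `P(f, g)`. -/
inductive PGen
  | a
  | c
  | d

/-- The defining relations of `P(f, g)`. -/
inductive PRel (f g : k[X]) : FreeAlgebra k PGen → FreeAlgebra k PGen → Prop
  | a_c : PRel f g (FreeAlgebra.ι k PGen.a * FreeAlgebra.ι k PGen.c)
      (FreeAlgebra.ι k PGen.c * FreeAlgebra.ι k PGen.a + aeval (FreeAlgebra.ι k PGen.c) f)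
  | d_c : PRel f g (FreeAlgebra.ι k PGen.d * FreeAlgebra.ι k PGen.c)
      (FreeAlgebra.ι k PGen.c * FreeAlgebra.ι k PGen.d + aeval (FreeAlgebra.ι k PGen.c) f)
  | d_a : PRel f g (FreeAlgebra.ι k PGen.d * FreeAlgebra.ι k PGen.a)
      ((FreeAlgebra.ι k PGen.a - aeval (FreeAlgebra.ι k PGen.c) g) * FreeAlgebra.ι k PGen.d
        + aeval (FreeAlgebra.ι k PGen.c) g * FreeAlgebra.ι k PGen.a)

/-- `P(f, g) = k⟨a, c, d | a c = c a + f, d c = c d + f, d a = (a - g) d + g a⟩`. -/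
def P (f g : k[X]) : Type _ := RingQuot (PRel f g)

instance (f g : k[X]) : Ring (P f g) := inferInstanceAs (Ring (RingQuot (PRel f g)))

instance (f g : k[X]) : Algebra k (P f g) := inferInstanceAs (Algebra k (RingQuot (PRel f g)))

/-- The generator `a` of `P(f, g)`. -/
def P.a (f g : k[X]) : P f g := RingQuot.mkAlgHom k (PRel f g) (FreeAlgebra.ι k PGen.a)

/-- The generator `c` of `P(f, g)`. -/
def P.c (f g : k[X]) : P f g := RingQuot.mkAlgHom k (PRel f g) (FreeAlgebra.ι k PGen.c)

/-- The generator `d` of `P(f, g)`. -/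
def P.d (f g : k[X]) : P f g := RingQuot.mkAlgHom k (PRel f g) (FreeAlgebra.ι k PGen.d)

/-- The element `u = d - a` of `P(f, g)`. -/
def P.u (f g : k[X]) : P f g := P.d f g - P.a f g

/-- The element `c - α` of `P(f, g)`. -/
def P.cSub (f g : k[X]) (α : k) : P f g := P.c f g - algebraMap k (P f g) α

/-- The element `u - β c` of `P(f, g)`. -/
def P.uSub (f g : k[X]) (β : k) : P f g := P.u f g - β • P.c f g

end DiffOp

end

noncomputable section

namespace DiffOp

open Polynomial

/-! ### Differential operator rings over a commutative ring -/

section Ore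

variable {k A B : Type*} [CommRing k] [CommRing A] [Algebra k A] [Ring B] [Algebra k B]

/-! Replace the generator `d` by `u = d - a`. Since `a` and `d` have the same commutator with `c`,
the element `u` commutes with `c`, and `a u = u a + g u`. As `f = c g`, also `a c = c a + g c`. Thus
`P(cg, g)` is the differential operator ring `k[u, c][a; g E]`, where `E` is the Euler derivation.
To see that the presented algebra has the expected basis, let it act on polynomials in `a` with left
coefficients in `k[u, c]`.

Two facts about `A[a; D]` carry the argument. If `D r ∈ A r`, then `r` is normal: it generates the
same ideal on either side and can be cancelled modulo a prime not containing it. In characteristic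
zero, for a domain `A` and `D ≠ 0`, commutators with an element of `A` lower the degree in `a`, so
every nonzero ideal meets `A`.

Let `I` be a nonzero prime. If `g(c) ∈ I`, splitting `g` into linear factors, all normal, puts some
`c - α` in `I`. Otherwise the normal element `g(c)` can be cancelled, so `I ∩ k[u, c]` is stable
under `E` and contains a nonzero binary form. Such a form splits into factors `c` and `u - β c`,
again normal, so `I` contains one of them.

Each quotient by one of these elements is identified by inverse homomorphisms. It is a domain, so
the listed ideals are prime. They are pairwise incomparable, and every nonzero prime contains one of
them; hence they are exactly the primes of height one. -/

lemma coeff_sum_monomial (D : Derivation k A A) (q : A[X]) (i : ℕ) :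
    (q.sum fun j r => monomial j (D r)).coeff i = D (q.coeff i) := by
  rw [sum_def, finsetSum_coeff]
  simp only [coeff_monomial]
  rw [Finset.sum_ite_eq' q.support i]
  split_ifs with hi
  · rfl
  · rw [notMem_support_iff.mp hi, map_zero]

/-- A derivation of `A` applied to the coefficients of a polynomial over `A`. -/
def coeffwise (D : Derivation k A A) : A[X] →ₗ[k] A[X] where
  toFun q := q.sum fun j r => monomial j (D r)
  map_add' p q := by ext i; simp only [coeff_sum_monomial, coeff_add, map_add]
  map_smul' s p := by
    ext i; simp only [coeff_sum_monomial, coeff_smul, Derivation.map_smul, RingHom.id_apply]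

@[simp]
lemma coeff_coeffwise (D : Derivation k A A) (q : A[X]) (i : ℕ) :
    (coeffwise D q).coeff i = D (q.coeff i) := coeff_sum_monomial D q i

/-- Left multiplication by the variable on the differential operator ring over `A`, in terms of
left coefficients. -/
def shift (D : Derivation k A A) : Module.End k A[X] :=
  LinearMap.mulLeft k X + coeffwise D

lemma shift_apply (D : Derivation k A A) (q : A[X]) : shift D q = X * q + coeffwise D q := rfl

@[simp]
lemma coeff_shift_zero (D : Derivation k A A) (q : A[X]) :
    (shift D q).coeff 0 = D (q.coeff 0) := by simp [shift_apply]

@[simp]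
lemma coeff_shift_succ (D : Derivation k A A) (q : A[X]) (i : ℕ) :
    (shift D q).coeff (i + 1) = q.coeff i + D (q.coeff (i + 1)) := by simp [shift_apply]

lemma coeff_shift_pow_eq_zero (D : Derivation k A A) {q : A[X]} {n : ℕ} (hq : q.natDegree ≤ n)
    (i : ℕ) {j : ℕ} (hj : n + i < j) : ((shift D ^ i) q).coeff j = 0 := by
  induction i generalizing j with
  | zero =>
    rw [pow_zero, Module.End.one_apply]
    exact coeff_eq_zero_of_natDegree_lt (by omega)
  | succ i ih =>
    obtain ⟨j, rfl⟩ : ∃ l, j = l + 1 := ⟨j - 1, by omega⟩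
    rw [pow_succ', Module.End.mul_apply, coeff_shift_succ, ih (by omega), ih (by omega), map_zero,
      add_zero]

lemma coeff_shift_pow_top (D : Derivation k A A) {q : A[X]} {n : ℕ} (hq : q.natDegree ≤ n)
    (i : ℕ) : ((shift D ^ i) q).coeff (n + i) = q.coeff n := by
  induction i with
  | zero => simp
  | succ i ih =>
    rw [pow_succ', Module.End.mul_apply, ← add_assoc, coeff_shift_succ, ih,
      coeff_shift_pow_eq_zero D hq i (by omega), map_zero, add_zero]

/-- Second term of the Leibniz expansion `aⁱ⁺¹ r = r aⁱ⁺¹ + (i + 1) (D r) aⁱ + ⋯`. Its integer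
factor is why characteristic zero matters later. -/
lemma coeff_shift_pow_C (D : Derivation k A A) (r : A) (i : ℕ) :
    ((shift D ^ (i + 1)) (C r)).coeff i = (i + 1) * D r := by
  induction i with
  | zero => simp
  | succ i ih =>
    have h := coeff_shift_pow_top D (natDegree_C r).le (i + 1)
    rw [zero_add, coeff_C_zero] at h
    rw [pow_succ', Module.End.mul_apply, coeff_shift_succ, ih, h]
    push_cast
    ring

/-- The product of the differential operator ring over `A`, in terms of left coefficients. -/
def star (D : Derivation k A A) (p q : A[X]) : A[X] :=
  p.sum fun i r => C r * (shift D ^ i) q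

lemma star_eq_sum_range (D : Derivation k A A) (p q : A[X]) {m : ℕ} (hp : p.natDegree ≤ m) :
    star D p q = ∑ i ∈ Finset.range (m + 1), C (p.coeff i) * (shift D ^ i) q :=
  sum_over_range' p (fun i => by simp) (m + 1) (by omega)

lemma coeff_star (D : Derivation k A A) (p q : A[X]) {m : ℕ} (hp : p.natDegree ≤ m) (j : ℕ) :
    (star D p q).coeff j =
      ∑ i ∈ Finset.range (m + 1), p.coeff i * ((shift D ^ i) q).coeff j := by
  simp [star_eq_sum_range D p q hp]

/-- Moving `a` past a coefficient changes only lower terms, so leading coefficients multiply as in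
the commutative case. -/
lemma coeff_star_top (D : Derivation k A A) (p q : A[X]) {m n : ℕ} (hp : p.natDegree ≤ m)
    (hq : q.natDegree ≤ n) : (star D p q).coeff (n + m) = p.coeff m * q.coeff n := by
  rw [coeff_star D p q hp, Finset.sum_range_succ, coeff_shift_pow_top D hq, Finset.sum_eq_zero,
    zero_add]
  intro i hi
  rw [coeff_shift_pow_eq_zero D hq i (by simp at hi; omega), mul_zero]

lemma natDegree_star_C_le (D : Derivation k A A) (p : A[X]) (r : A) :
    (star D p (C r)).natDegree ≤ p.natDegree := by
  rw [natDegree_le_iff_coeff_eq_zero]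
  intro j hj
  rw [coeff_star D p _ le_rfl]
  refine Finset.sum_eq_zero fun i hi => ?_
  rw [coeff_shift_pow_eq_zero D (natDegree_C r).le i (by simp at hi; omega), mul_zero]

lemma coeff_star_C (D : Derivation k A A) (p : A[X]) (r : A) {m : ℕ} (hp : p.natDegree ≤ m + 1) :
    (star D p (C r)).coeff m = p.coeff m * r + p.coeff (m + 1) * ((m + 1) * D r) := by
  have h := coeff_shift_pow_top D (natDegree_C r).le m
  rw [zero_add, coeff_C_zero] at h
  rw [coeff_star D p _ hp, Finset.sum_range_succ, Finset.sum_range_succ, coeff_shift_pow_C, h,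
    Finset.sum_eq_zero, zero_add]
  intro i hi
  rw [coeff_shift_pow_eq_zero D (natDegree_C r).le i (by simp at hi; omega), mul_zero]

/-- Since `D 1 = 0`, letting an operator act on `1` reads off its left coefficients; this gives
uniqueness of normal forms. -/
lemma star_one (D : Derivation k A A) (p : A[X]) : star D p 1 = p := by
  have h (i : ℕ) : (shift D ^ i) (1 : A[X]) = X ^ i := by
    induction i with
    | zero => simp
    | succ i ih =>
      rw [pow_succ', Module.End.mul_apply, ih, shift_apply, pow_succ']
      have : coeffwise D (X ^ i : A[X]) = 0 := by
        ext j
        rw [coeff_coeffwise, coeff_X_pow]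
        split_ifs <;> simp
      rw [this, add_zero]
  simp only [star, h]
  exact sum_C_mul_X_pow_eq p

/-- The `k`-algebra `B` is, by means of `φ : A → B` and `a : B`, the differential operator ring
`A[a; D]`: one has `a r = r a + D r` for `r ∈ A`, and the elements of `B` can be written uniquely
in the form `∑ rᵢ aⁱ`. -/
structure IsDiffOpRing (D : Derivation k A A) (φ : A →ₐ[k] B) (a : B) : Prop where
  comm : ∀ r, a * φ r = φ r * a + φ (D r)
  bij : Function.Bijective (eval₂ (φ : A →+* B) a)

/-- The left multiplication action of `A` on `A[X]`. -/
def mulC (k A : Type*) [CommRing k] [CommRing A] [Algebra k A] : A →ₐ[k] Module.End k A[X] :=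
  (Algebra.lmul k A[X]).comp ((Algebra.ofId A A[X]).restrictScalars k)

lemma mulC_apply (r : A) (q : A[X]) : mulC k A r q = C r * q := rfl

lemma shift_mul_mulC (D : Derivation k A A) (r : A) :
    shift D * mulC k A r = mulC k A r * shift D + mulC k A (D r) := by
  ext1 q
  simp only [Module.End.mul_apply, LinearMap.add_apply, mulC_apply]
  ext i
  cases i with
  | zero => simp; ring
  | succ i => simp; ring

lemma eval₂_C_mul_left (φ : A →+* B) (a : B) (r : A) (q : A[X]) :
    eval₂ φ a (C r * q) = φ r * eval₂ φ a q := by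
  induction q using Polynomial.induction_on' with
  | add p q hp hq => rw [mul_add, eval₂_add, eval₂_add, hp, hq, mul_add]
  | monomial n s => rw [C_mul_monomial, eval₂_monomial, eval₂_monomial, map_mul, mul_assoc]

variable {D : Derivation k A A} {φ : A →ₐ[k] B} {a : B}

lemma mul_eval₂_of_comm (h : ∀ r, a * φ r = φ r * a + φ (D r)) (q : A[X]) :
    a * eval₂ (φ : A →+* B) a q = eval₂ (φ : A →+* B) a (shift D q) := by
  induction q using Polynomial.induction_on' with
  | add p q hp hq => rw [map_add, eval₂_add, eval₂_add, mul_add, hp, hq]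
  | monomial n s =>
    have : shift D (monomial n s) = monomial (n + 1) s + monomial n (D s) := by
      rw [shift_apply, X_mul_monomial]
      congr 1
      ext i
      rw [coeff_coeffwise, coeff_monomial, coeff_monomial]
      split_ifs <;> simp
    rw [this, eval₂_add, eval₂_monomial, eval₂_monomial, eval₂_monomial, ← mul_assoc,
      RingHom.coe_coe, h, pow_succ']
    noncomm_ring

/-- The commutation rule alone makes `star` describe products in `B`, so the elements in normal form
are closed under multiplication before the normal form is known to be unique. -/
lemma eval₂_mul_of_comm (h : ∀ r, a * φ r = φ r * a + φ (D r)) (p q : A[X]) :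
    eval₂ (φ : A →+* B) a p * eval₂ (φ : A →+* B) a q = eval₂ (φ : A →+* B) a (star D p q) := by
  have hpow (i : ℕ) : a ^ i * eval₂ (φ : A →+* B) a q =
      eval₂ (φ : A →+* B) a ((shift D ^ i) q) := by
    induction i with
    | zero => simp
    | succ i ih =>
      rw [pow_succ', mul_assoc, ih, mul_eval₂_of_comm h, pow_succ', Module.End.mul_apply]
  rw [star, sum_def, eval₂_finsetSum, eval₂_eq_sum, sum_def, Finset.sum_mul]
  refine Finset.sum_congr rfl fun i _ => ?_
  rw [eval₂_C_mul_left, ← hpow, mul_assoc]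

/-- A differential operator ring is recognised by its action on `A[X]`. -/
lemma IsDiffOpRing.of_rep (h : ∀ r, a * φ r = φ r * a + φ (D r))
    (ρ : B →ₐ[k] Module.End k A[X]) (hφ : ∀ r, ρ (φ r) = mulC k A r) (ha : ρ a = shift D)
    (htop : ∀ S : Subalgebra k B, (∀ r, φ r ∈ S) → a ∈ S → S = ⊤) : IsDiffOpRing D φ a := by
  refine ⟨h, fun p q hpq => ?_, fun b => ?_⟩
  -- Uniqueness: the image of `1` under the action recovers the polynomial.
  · have key (p : A[X]) : ρ (eval₂ (φ : A →+* B) a p) 1 = p := by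
      conv_rhs => rw [← star_one D p]
      rw [star, eval₂_eq_sum, sum_def, sum_def, map_sum, LinearMap.sum_apply]
      refine Finset.sum_congr rfl fun i _ => ?_
      rw [map_mul, map_pow, ha, RingHom.coe_coe, hφ, Module.End.mul_apply, mulC_apply]
    rw [← key p, ← key q, hpq]
  · let S : Subalgebra k B :=
      { carrier := Set.range (eval₂ (φ : A →+* B) a)
        mul_mem' := by
          rintro _ _ ⟨p, rfl⟩ ⟨q, rfl⟩
          exact ⟨_, (eval₂_mul_of_comm h p q).symm⟩
        add_mem' := by
          rintro _ _ ⟨p, rfl⟩ ⟨q, rfl⟩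
          exact ⟨p + q, eval₂_add _ _⟩
        algebraMap_mem' := fun r => ⟨C (algebraMap k A r), by simp⟩ }
    have hS : S = ⊤ := htop S (fun r => ⟨C r, by simp⟩) ⟨X, by simp⟩
    exact hS.ge (Algebra.mem_top : b ∈ ⊤)

namespace IsDiffOpRing

variable (H : IsDiffOpRing D φ a)
include H

lemma eval₂_mul (p q : A[X]) :
    eval₂ (φ : A →+* B) a p * eval₂ (φ : A →+* B) a q = eval₂ (φ : A →+* B) a (star D p q) :=
  eval₂_mul_of_comm H.comm p q

lemma injective : Function.Injective φ := fun r s h =>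
  C_injective (H.bij.1 (by simpa using h))

lemma isDomain [IsDomain A] : IsDomain B := by
  have h0 : eval₂ (φ : A →+* B) a 0 = 0 := eval₂_zero _ _
  have : Nontrivial B := H.injective.nontrivial
  have : NoZeroDivisors B := by
    refine ⟨fun {x y} hxy => ?_⟩
    obtain ⟨p, rfl⟩ := H.bij.2 x
    obtain ⟨q, rfl⟩ := H.bij.2 y
    rw [H.eval₂_mul, ← h0] at hxy
    have hc := coeff_star_top D p q le_rfl le_rfl
    rw [H.bij.1 hxy, coeff_zero, eq_comm, mul_eq_zero, coeff_natDegree, coeff_natDegree,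
      leadingCoeff_eq_zero, leadingCoeff_eq_zero] at hc
    rcases hc with rfl | rfl
    · exact .inl h0
    · exact .inr h0
  exact NoZeroDivisors.to_isDomain B

/-- In characteristic zero, a nonzero ideal of `A[a; D]` with `D ≠ 0` meets `A`. -/
lemma exists_mem_of_ne_zero [IsDomain A] [CharZero A] (hD : ∃ r, D r ≠ 0) (I : TwoSidedIdeal B)
    {x : B} (hx : x ∈ I) (hx0 : x ≠ 0) : ∃ r : A, r ≠ 0 ∧ φ r ∈ I := by
  obtain ⟨s, hs⟩ := hD
  have key (n : ℕ) : ∀ p : A[X], p ≠ 0 → p.natDegree = n → eval₂ (φ : A →+* B) a p ∈ I →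
      ∃ r : A, r ≠ 0 ∧ φ r ∈ I := by
    induction n with
    | zero =>
      intro p hp0 hp hpI
      rw [eq_C_of_natDegree_eq_zero hp] at hp0 hpI
      exact ⟨p.coeff 0, by simpa using hp0, by simpa using hpI⟩
    | succ n ih =>
      intro p hp0 hp hpI
      -- In the commutator with `s` the terms of degree `n + 1` cancel because `A` is commutative;
      -- the next coefficient survives, so the degree drops by exactly one.
      have hc : (star D p (C s) - C s * p).coeff n = p.coeff (n + 1) * ((n + 1) * D s) := by
        rw [coeff_sub, coeff_star_C D p s hp.le, coeff_C_mul]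
        ring
      have hne : (star D p (C s) - C s * p).coeff n ≠ 0 := by
        rw [hc, ← hp, coeff_natDegree]
        exact mul_ne_zero (leadingCoeff_ne_zero.mpr hp0)
          (mul_ne_zero (by exact_mod_cast n.succ_ne_zero) hs)
      refine ih (star D p (C s) - C s * p) (fun h => hne (by rw [h, coeff_zero])) ?_ ?_
      · refine le_antisymm ?_ (le_natDegree_of_ne_zero hne)
        rw [natDegree_le_iff_coeff_eq_zero]
        intro j hj
        rcases (Nat.succ_le_of_lt hj).eq_or_lt with rfl | hj
        · have := coeff_star_top D p (C s) hp.le (natDegree_C s).le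
          rw [zero_add, coeff_C_zero] at this
          rw [coeff_sub, this, coeff_C_mul]
          ring
        · rw [coeff_sub, coeff_C_mul, coeff_eq_zero_of_natDegree_lt
            ((natDegree_star_C_le D p s).trans_lt (by omega)),
            coeff_eq_zero_of_natDegree_lt (by omega), mul_zero, sub_zero]
      · have h1 : eval₂ (φ : A →+* B) a (star D p (C s)) ∈ I := by
          rw [← H.eval₂_mul]
          exact I.mul_mem_right _ _ hpI
        have h2 : eval₂ (φ : A →+* B) a (C s * p) ∈ I := by
          rw [eval₂_C_mul_left]
          exact I.mul_mem_left _ _ hpI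
        have h3 := eval₂_add (φ : A →+* B) a (p := star D p (C s) - C s * p) (q := C s * p)
        rw [sub_add_cancel] at h3
        rw [← add_sub_cancel_right (eval₂ (φ : A →+* B) a (star D p (C s) - C s * p)), ← h3]
        exact I.sub_mem h1 h2
  obtain ⟨p, rfl⟩ := H.bij.2 x
  exact key _ p (fun h => hx0 (by rw [h, eval₂_zero])) rfl hx

/-- Every element of `A[a; D]` belongs to each additive and multiplicative set that contains
`A` and `a`. -/
lemma induction {motive : B → Prop} (hφ : ∀ r, motive (φ r)) (ha : motive a)
    (hadd : ∀ x y, motive x → motive y → motive (x + y))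
    (hmul : ∀ x y, motive x → motive y → motive (x * y)) (x : B) : motive x := by
  obtain ⟨p, rfl⟩ := H.bij.2 x
  induction p using Polynomial.induction_on' with
  | add p q hp hq => rw [eval₂_add]; exact hadd _ _ hp hq
  | monomial n r =>
    rw [eval₂_monomial]
    induction n with
    | zero => simpa using hφ r
    | succ n ih => rw [pow_succ, ← mul_assoc]; exact hmul _ _ ih ha

/-- Here `a r = r (a + s)`, and the property passes to sums and products. With the mirror statement
below, `r` is a normal element. -/
lemma exists_mul_eq_left {r s : A} (h : D r = s * r) (x : B) : ∃ y, x * φ r = φ r * y := by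
  induction x using H.induction with
  | hφ t => exact ⟨φ t, by rw [← map_mul, ← map_mul, mul_comm]⟩
  | ha => exact ⟨a + φ s, by rw [H.comm, h, mul_add, mul_comm, map_mul]⟩
  | hadd x y hx hy =>
    obtain ⟨x', hx⟩ := hx
    obtain ⟨y', hy⟩ := hy
    exact ⟨x' + y', by rw [add_mul, hx, hy, mul_add]⟩
  | hmul x y hx hy =>
    obtain ⟨x', hx⟩ := hx
    obtain ⟨y', hy⟩ := hy
    exact ⟨x' * y', by rw [mul_assoc, hy, ← mul_assoc, hx, mul_assoc]⟩

lemma exists_mul_eq_right {r s : A} (h : D r = s * r) (x : B) : ∃ y, φ r * x = y * φ r := by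
  induction x using H.induction with
  | hφ t => exact ⟨φ t, by rw [← map_mul, ← map_mul, mul_comm]⟩
  | ha => exact ⟨a - φ s, by rw [sub_mul, H.comm, h, map_mul, add_sub_cancel_right]⟩
  | hadd x y hx hy =>
    obtain ⟨x', hx⟩ := hx
    obtain ⟨y', hy⟩ := hy
    exact ⟨x' + y', by rw [mul_add, hx, hy, add_mul]⟩
  | hmul x y hx hy =>
    obtain ⟨x', hx⟩ := hx
    obtain ⟨y', hy⟩ := hy
    exact ⟨x' * y', by rw [← mul_assoc, hx, mul_assoc, hy, ← mul_assoc]⟩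

/-- If `D r ∈ A r`, then the ideal of `A[a; D]` generated by `r` is the right ideal generated
by `r`. -/
lemma coe_span_singleton {r s : A} (h : D r = s * r) :
    (TwoSidedIdeal.span {φ r} : Set B) = Set.range (fun x : B => φ r * x) := by
  apply Set.Subset.antisymm
  · let J : TwoSidedIdeal B := .mk' (Set.range fun x : B => φ r * x) ⟨0, mul_zero _⟩
      (by rintro _ _ ⟨x, rfl⟩ ⟨y, rfl⟩; exact ⟨x + y, mul_add _ _ _⟩)
      (by rintro _ ⟨x, rfl⟩; exact ⟨-x, mul_neg _ _⟩)
      (by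
        rintro x _ ⟨y, rfl⟩
        obtain ⟨z, hz⟩ := H.exists_mul_eq_left h x
        exact ⟨z * y, by simp only [← mul_assoc, hz]⟩)
      (by rintro _ y ⟨x, rfl⟩; exact ⟨x * y, (mul_assoc _ _ _).symm⟩)
    have hJ : (J : Set B) = Set.range fun x : B => φ r * x := TwoSidedIdeal.coe_mk' ..
    rw [← hJ]
    refine TwoSidedIdeal.span_le.mpr ?_
    rw [hJ]
    rintro _ rfl
    exact ⟨1, mul_one _⟩
  · rintro _ ⟨x, rfl⟩
    exact TwoSidedIdeal.mul_mem_right _ _ _ (TwoSidedIdeal.subset_span rfl)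

/-- If `D r ∈ A r`, then `r` is a prime-like divisor with respect to the prime ideals of
`A[a; D]`. -/
lemma mem_or_mem {I : TwoSidedIdeal B} (hI : IsPrimeIdeal I) {r s : A} (h : D r = s * r) {x : B}
    (hx : φ r * x ∈ I) : φ r ∈ I ∨ x ∈ I := by
  refine hI.mem_or_mem _ _ fun y => ?_
  obtain ⟨z, hz⟩ := H.exists_mul_eq_right h y
  rw [hz, mul_assoc]
  exact I.mul_mem_left _ _ hx

/-- The contraction to `A` of an ideal of `A[a; D]` is stable under `D`. -/
lemma derivation_mem {I : TwoSidedIdeal B} {r : A} (h : φ r ∈ I) : φ (D r) ∈ I := by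
  have := I.sub_mem (I.mul_mem_left a _ h) (I.mul_mem_right _ a h)
  rwa [H.comm, add_sub_cancel_left] at this

end IsDiffOpRing

end Ore

/-! ### Presentations of `R_f` and `P(f, g)`, and their structure as differential operator rings -/

section Presentations

variable {k : Type*} [Field k] {S : Type*} [Ring S] [Algebra k S]

lemma R.a_mul_c (f : k[X]) : R.a f * R.c f = R.c f * R.a f + aeval (R.c f) f := by
  have h := RingQuot.mkAlgHom_rel k (RRel.a_c (f := f))
  rw [map_mul, map_add, map_mul, ← aeval_algHom_apply] at h
  exact h

/-- The homomorphism from `R_f` given by the images of the generators. -/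
def R.lift (f : k[X]) (x y : S) (h : x * y = y * x + aeval y f) : R f →ₐ[k] S :=
  RingQuot.liftAlgHom k ⟨FreeAlgebra.lift k (fun | .a => x | .c => y), by
    rintro _ _ ⟨⟩
    simpa [← aeval_algHom_apply] using h⟩

@[simp]
lemma R.lift_a (f : k[X]) (x y : S) (h : x * y = y * x + aeval y f) :
    R.lift f x y h (R.a f) = x := by
  refine (RingQuot.liftAlgHom_mkAlgHom_apply k _ _ _).trans ?_
  simp

@[simp]
lemma R.lift_c (f : k[X]) (x y : S) (h : x * y = y * x + aeval y f) :
    R.lift f x y h (R.c f) = y := by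
  refine (RingQuot.liftAlgHom_mkAlgHom_apply k _ _ _).trans ?_
  simp

lemma R.eq_top (f : k[X]) (T : Subalgebra k (R f)) (ha : R.a f ∈ T) (hc : R.c f ∈ T) : T = ⊤ := by
  refine eq_top_iff.mpr fun x _ => ?_
  obtain ⟨x, rfl⟩ := RingQuot.mkAlgHom_surjective k (RRel f) x
  induction x using FreeAlgebra.induction with
  | grade0 r => exact (AlgHom.commutes (RingQuot.mkAlgHom k (RRel f)) r) ▸ T.algebraMap_mem r
  | grade1 i => cases i <;> assumption
  | mul x y hx hy =>
    rw [map_mul]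
    exact T.mul_mem (hx Algebra.mem_top) (hy Algebra.mem_top)
  | add x y hx hy =>
    rw [map_add]
    exact T.add_mem (hx Algebra.mem_top) (hy Algebra.mem_top)

lemma R.hom_ext {f : k[X]} {F G : R f →ₐ[k] S} (ha : F (R.a f) = G (R.a f))
    (hc : F (R.c f) = G (R.c f)) : F = G :=
  AlgHom.ext fun x => (R.eq_top f (AlgHom.equalizer F G) ha hc).ge (Algebra.mem_top : x ∈ ⊤)

lemma P.a_mul_c (f g : k[X]) :
    P.a f g * P.c f g = P.c f g * P.a f g + aeval (P.c f g) f := by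
  have h := RingQuot.mkAlgHom_rel k (PRel.a_c (f := f) (g := g))
  rw [map_mul, map_add, map_mul, ← aeval_algHom_apply] at h
  exact h

lemma P.d_mul_c (f g : k[X]) :
    P.d f g * P.c f g = P.c f g * P.d f g + aeval (P.c f g) f := by
  have h := RingQuot.mkAlgHom_rel k (PRel.d_c (f := f) (g := g))
  rw [map_mul, map_add, map_mul, ← aeval_algHom_apply] at h
  exact h

lemma P.d_mul_a (f g : k[X]) : P.d f g * P.a f g =
    (P.a f g - aeval (P.c f g) g) * P.d f g + aeval (P.c f g) g * P.a f g := by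
  have h := RingQuot.mkAlgHom_rel k (PRel.d_a (f := f) (g := g))
  rw [map_mul, map_add, map_mul, map_mul, map_sub, ← aeval_algHom_apply] at h
  exact h

lemma P.u_mul_c (f g : k[X]) : P.u f g * P.c f g = P.c f g * P.u f g := by
  rw [P.u, sub_mul, mul_sub, P.a_mul_c, P.d_mul_c, add_sub_add_right_eq_sub]

lemma P.a_mul_u (f g : k[X]) :
    P.a f g * P.u f g = P.u f g * P.a f g + aeval (P.c f g) g * P.u f g := by
  rw [P.u, sub_mul, mul_sub, P.d_mul_a]
  noncomm_ring

/-- The homomorphism from `P(f, g)` given by the images of `a`, `c` and `u`. -/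
def P.lift (f g : k[X]) (x y z : S) (h₁ : x * y = y * x + aeval y f) (h₂ : z * y = y * z)
    (h₃ : x * z = z * x + aeval y g * z) : P f g →ₐ[k] S :=
  -- The image of `d` is forced by `d = u + a`.
  RingQuot.liftAlgHom k ⟨FreeAlgebra.lift k (fun | .a => x | .c => y | .d => z + x), by
    rintro _ _ (⟨⟩ | ⟨⟩ | ⟨⟩)
    · simpa [← aeval_algHom_apply] using h₁
    · simp only [map_mul, map_add, FreeAlgebra.lift_ι_apply, ← aeval_algHom_apply]
      rw [add_mul, h₁, h₂]
      noncomm_ring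
    · simp only [map_mul, map_add, map_sub, FreeAlgebra.lift_ι_apply, ← aeval_algHom_apply]
      rw [sub_mul, mul_add x, h₃]
      noncomm_ring⟩

section

variable (f g : k[X]) (x y z : S) (h₁ : x * y = y * x + aeval y f) (h₂ : z * y = y * z)
    (h₃ : x * z = z * x + aeval y g * z)

@[simp]
lemma P.lift_a : P.lift f g x y z h₁ h₂ h₃ (P.a f g) = x := by
  refine (RingQuot.liftAlgHom_mkAlgHom_apply k _ _ _).trans ?_
  simp

@[simp]
lemma P.lift_c : P.lift f g x y z h₁ h₂ h₃ (P.c f g) = y := by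
  refine (RingQuot.liftAlgHom_mkAlgHom_apply k _ _ _).trans ?_
  simp

@[simp]
lemma P.lift_u : P.lift f g x y z h₁ h₂ h₃ (P.u f g) = z := by
  have h : P.lift f g x y z h₁ h₂ h₃ (P.d f g) = z + x := by
    refine (RingQuot.liftAlgHom_mkAlgHom_apply k _ _ _).trans ?_
    simp
  rw [P.u, map_sub, h, P.lift_a, add_sub_cancel_right]

end

lemma P.eq_top (f g : k[X]) (T : Subalgebra k (P f g)) (ha : P.a f g ∈ T) (hc : P.c f g ∈ T)
    (hu : P.u f g ∈ T) : T = ⊤ := by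
  have hd : P.d f g ∈ T := by simpa [P.u] using T.add_mem hu ha
  refine eq_top_iff.mpr fun x _ => ?_
  obtain ⟨x, rfl⟩ := RingQuot.mkAlgHom_surjective k (PRel f g) x
  induction x using FreeAlgebra.induction with
  | grade0 r => exact (AlgHom.commutes (RingQuot.mkAlgHom k (PRel f g)) r) ▸ T.algebraMap_mem r
  | grade1 i => cases i <;> assumption
  | mul x y hx hy =>
    rw [map_mul]
    exact T.mul_mem (hx Algebra.mem_top) (hy Algebra.mem_top)
  | add x y hx hy =>
    rw [map_add]
    exact T.add_mem (hx Algebra.mem_top) (hy Algebra.mem_top)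

lemma P.hom_ext {f g : k[X]} {F G : P f g →ₐ[k] S} (ha : F (P.a f g) = G (P.a f g))
    (hc : F (P.c f g) = G (P.c f g)) (hu : F (P.u f g) = G (P.u f g)) : F = G :=
  AlgHom.ext fun x => (P.eq_top f g (AlgHom.equalizer F G) ha hc hu).ge (Algebra.mem_top : x ∈ ⊤)

open scoped IsMulCommutative in
/-- Two commuting elements of an algebra are the images of the variables under a homomorphism
from the polynomial ring in two variables. -/
lemma exists_algHom_of_commute {x y : S} (h : x * y = y * x) :
    ∃ φ : MvPolynomial (Fin 2) k →ₐ[k] S, φ (.X 0) = x ∧ φ (.X 1) = y := by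
  have hs : ∀ a ∈ ({x, y} : Set S), ∀ b ∈ ({x, y} : Set S), a * b = b * a := by
    rintro _ (rfl | rfl) _ (rfl | rfl) <;> first | rfl | exact h | exact h.symm
  have := Algebra.isMulCommutative_adjoin k hs
  refine ⟨(Algebra.adjoin k {x, y}).val.comp (MvPolynomial.aeval
    ![⟨x, Algebra.subset_adjoin (by simp)⟩, ⟨y, Algebra.subset_adjoin (by simp)⟩]), ?_, ?_⟩ <;> simp

/-- Both `r ↦ a φ(r) - φ(r) a` and `φ ∘ D` are derivations along `φ`, so agreement on generators
suffices. -/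
lemma comm_of_adjoin_eq_top {A : Type*} [CommRing A] [Algebra k A] {D : Derivation k A A}
    {φ : A →ₐ[k] S} {a : S} {s : Set A} (hs : Algebra.adjoin k s = ⊤)
    (h : ∀ r ∈ s, a * φ r = φ r * a + φ (D r)) (r : A) : a * φ r = φ r * a + φ (D r) := by
  have hr : r ∈ Algebra.adjoin k s := hs ▸ Algebra.mem_top
  induction hr using Algebra.adjoin_induction with
  | mem x hx => exact h x hx
  | algebraMap x => simp [Algebra.commutes]
  | add x y _ _ hx hy => rw [map_add, map_add, map_add, mul_add, hx, hy]; noncomm_ring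
  | mul x y _ _ hx hy =>
    rw [Derivation.leibniz, map_mul, ← mul_assoc, hx, add_mul, mul_assoc, hy, map_add, smul_eq_mul,
      smul_eq_mul, map_mul, map_mul, ← map_mul φ (D x), mul_comm (D x), map_mul]
    noncomm_ring

/-- The derivation `f d/dc` of `k[c]`. -/
abbrev R.derivation (f : k[X]) : Derivation k k[X] k[X] := mkDerivation k f

/-- `R_f` is the differential operator ring `k[c][a; f d/dc]`. -/
lemma R.isDiffOpRing (f : k[X]) : IsDiffOpRing (R.derivation f) (aeval (R.c f)) (R.a f) := by
  refine .of_rep (comm_of_adjoin_eq_top (s := {X}) adjoin_X ?_)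
    (R.lift f (shift (R.derivation f)) (mulC k k[X] X) ?_) ?_ (R.lift_a ..) ?_
  · rintro _ rfl
    simp [R.a_mul_c]
  · rw [shift_mul_mulC, mkDerivation_X, aeval_algHom_apply, aeval_X_left_apply]
  · intro r
    rw [← aeval_algHom_apply, R.lift_c, aeval_algHom_apply, aeval_X_left_apply]
  · intro T hφ ha
    exact R.eq_top f T ha (by simpa using hφ X)

instance (f : k[X]) : IsDomain (R f) := (R.isDiffOpRing f).isDomain

lemma R.aeval_c_injective (f : k[X]) : Function.Injective (aeval (R := k) (R.c f)) :=
  (R.isDiffOpRing f).injective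

/-- The derivation `g(c) (c ∂/∂c + u ∂/∂u)` of `k[u, c]`, where `u` and `c` are the variables with
numbers `0` and `1`. -/
abbrev P.derivation (g : k[X]) :
    Derivation k (MvPolynomial (Fin 2) k) (MvPolynomial (Fin 2) k) :=
  MvPolynomial.mkDerivation k fun i => aeval (MvPolynomial.X 1) g * MvPolynomial.X i

/-- The homomorphism `k[u, c] → P(f, g)`. -/
def P.incl (f g : k[X]) : MvPolynomial (Fin 2) k →ₐ[k] P f g :=
  (exists_algHom_of_commute (P.u_mul_c f g)).choose

@[simp]
lemma P.incl_X_zero (f g : k[X]) : P.incl f g (.X 0) = P.u f g :=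
  (exists_algHom_of_commute (P.u_mul_c f g)).choose_spec.1

@[simp]
lemma P.incl_X_one (f g : k[X]) : P.incl f g (.X 1) = P.c f g :=
  (exists_algHom_of_commute (P.u_mul_c f g)).choose_spec.2

/-- The role of `f = c g`: it gives the relation between `a` and `c` the same shape as the one
between `a` and `u`. -/
lemma aeval_of_eq_X_mul {f g : k[X]} (hfg : f = X * g) (y : S) :
    aeval y f = aeval y g * y := by
  rw [hfg, mul_comm, map_mul, aeval_X]

/-- `P(cg, g)` is the differential operator ring `k[u, c][a; g(c) (c ∂/∂c + u ∂/∂u)]`. -/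
lemma P.isDiffOpRing {f g : k[X]} (hfg : f = X * g) :
    IsDiffOpRing (P.derivation g) (P.incl f g) (P.a f g) := by
  refine .of_rep (comm_of_adjoin_eq_top (MvPolynomial.adjoin_range_X (R := k)) ?_)
    (P.lift f g (shift (P.derivation g)) (mulC k _ (.X 1)) (mulC k _ (.X 0)) ?_ ?_ ?_) ?_
    (P.lift_a ..) ?_
  · rintro _ ⟨i, rfl⟩
    rw [MvPolynomial.mkDerivation_X, map_mul, ← aeval_algHom_apply]
    fin_cases i
    · simpa using P.a_mul_u f g
    · have h := P.a_mul_c f g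
      rw [aeval_of_eq_X_mul hfg] at h
      simpa using h
  · rw [shift_mul_mulC, MvPolynomial.mkDerivation_X, ← aeval_of_eq_X_mul hfg, aeval_algHom_apply]
  · rw [← map_mul, ← map_mul, mul_comm]
  · rw [shift_mul_mulC, MvPolynomial.mkDerivation_X, aeval_algHom_apply, map_mul]
  · refine fun r => DFunLike.congr_fun (MvPolynomial.algHom_ext (f := (P.lift f g _ _ _ _ _ _).comp
      (P.incl f g)) (g := mulC k _) fun i => ?_) r
    fin_cases i <;> simp
  · intro T hφ ha
    exact P.eq_top f g T ha (by simpa using hφ (.X 1)) (by simpa using hφ (.X 0))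

lemma P.isDomain {f g : k[X]} (hfg : f = X * g) : IsDomain (P f g) :=
  (P.isDiffOpRing hfg).isDomain

end Presentations

/-! ### The quotients by `c - α` and by `u - β c` -/

section Quotients

variable {k : Type*} [Field k]

section

variable {B S : Type*} [Ring B] [Algebra k B] [Ring S] [Algebra k S] {x : B}

lemma cls_eq_zero_iff {r : B} : cls x r = 0 ↔ r ∈ TwoSidedIdeal.span {x} :=
  (RingCon.eq _).trans (TwoSidedIdeal.mem_iff _ _).symm

lemma mem_span_self (x : B) : x ∈ TwoSidedIdeal.span {x} := TwoSidedIdeal.subset_span rfl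

/-- The residue class map `B → B / (x)`. -/
abbrev clsHom (k : Type*) [Field k] {B : Type*} [Ring B] [Algebra k B] (x : B) :
    B →ₐ[k] QuotBy x := RingCon.mkₐ k _

lemma clsHom_self (x : B) : clsHom k x x = 0 := cls_eq_zero_iff.mpr (mem_span_self x)

/-- A homomorphism `F : B → S` that kills `x` induces an isomorphism `B / (x) ≃ S` if it has an
inverse `G` modulo `x`. -/
lemma exists_quotBy_algEquiv (F : B →ₐ[k] S) (hF : F x = 0) (G : S →ₐ[k] QuotBy x)
    (hGF : G.comp F = clsHom k x)
    (hFG : ∀ F' : QuotBy x →ₐ[k] S, (∀ r, F' (clsHom k x r) = F r) → F'.comp G = .id k S) :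
    ∃ e : QuotBy x ≃ₐ[k] S, ∀ r, e (cls x r) = F r := by
  have hle : TwoSidedIdeal.span {x} ≤ TwoSidedIdeal.ker F :=
    TwoSidedIdeal.span_le.mpr (by rintro _ rfl; exact (TwoSidedIdeal.mem_ker F).mpr hF)
  have hker : (TwoSidedIdeal.span {x}).ringCon ≤ RingCon.ker F.toRingHom := fun r s hrs =>
    TwoSidedIdeal.ringCon_le_iff.mp hle hrs
  exact ⟨AlgEquiv.ofAlgHom (RingCon.liftₐ _ F hker) G (hFG _ fun r => rfl)
    (RingCon.Quotient.hom_extₐ hGF), fun r => rfl⟩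

end

variable {f g : k[X]}

lemma P.clsHom_cSub_c (α : k) : clsHom k (P.cSub f g α) (P.c f g) =
    algebraMap k (QuotBy (P.cSub f g α)) α := by
  have h := clsHom_self (k := k) (P.cSub f g α)
  rwa [P.cSub, map_sub, AlgHom.commutes, sub_eq_zero] at h

lemma P.clsHom_uSub_u (β : k) :
    clsHom k (P.uSub f g β) (P.u f g) = β • clsHom k (P.uSub f g β) (P.c f g) := by
  have h := clsHom_self (k := k) (P.uSub f g β)
  rwa [P.uSub, map_sub, map_smul, sub_eq_zero] at h

lemma aeval_algebraMap_eq {S : Type*} [Ring S] [Algebra k S] (α : k) (p : k[X]) :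
    aeval (algebraMap k S α) p = algebraMap k S (p.eval α) := by
  rw [aeval_algebraMap_apply, coe_aeval_eq_eval]

/-- Modulo `c - α` the generators `a` and `u` remain, and the scalar `g(α)` decides between a
polynomial ring and an enveloping algebra. -/
lemma P.clsHom_a_mul_u (α : k) :
    clsHom k (P.cSub f g α) (P.a f g) * clsHom k (P.cSub f g α) (P.u f g) =
      clsHom k (P.cSub f g α) (P.u f g) * clsHom k (P.cSub f g α) (P.a f g) +
        g.eval α • clsHom k (P.cSub f g α) (P.u f g) := by
  rw [← map_mul, P.a_mul_u, map_add, map_mul, map_mul, ← aeval_algHom_apply, P.clsHom_cSub_c,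
    aeval_algebraMap_eq, ← Algebra.smul_def]

lemma P.exists_quot_cSub_algEquiv_mvPolynomial {α : k} (hf : f.eval α = 0) (hg : g.eval α = 0) :
    ∃ e : QuotBy (P.cSub f g α) ≃ₐ[k] MvPolynomial (Fin 2) k,
      e (cls (P.cSub f g α) (P.a f g)) = MvPolynomial.X 0 ∧
      e (cls (P.cSub f g α) (P.u f g)) = MvPolynomial.X 1 := by
  let F : P f g →ₐ[k] MvPolynomial (Fin 2) k :=
    P.lift f g (.X 0) (algebraMap k _ α) (.X 1)
      (by rw [aeval_algebraMap_eq, hf, map_zero, add_zero, mul_comm]) (mul_comm _ _)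
      (by rw [aeval_algebraMap_eq, hg, map_zero, zero_mul, add_zero, mul_comm])
  have hau := P.clsHom_a_mul_u (f := f) (g := g) α
  rw [hg, zero_smul, add_zero] at hau
  obtain ⟨G, hG0, hG1⟩ := exists_algHom_of_commute (k := k) hau
  obtain ⟨e, he⟩ := exists_quotBy_algEquiv F (by simp [F, P.cSub]) G
    (P.hom_ext (by simp [F, hG0]) (by rw [P.clsHom_cSub_c]; simp [F]) (by simp [F, hG1]))
    (fun F' hF' => MvPolynomial.algHom_ext fun i => by
      fin_cases i
      · simp only [Fin.zero_eta, AlgHom.comp_apply, hG0, hF']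
        simp [F]
      · simp only [Fin.mk_one, AlgHom.comp_apply, hG1, hF']
        simp [F])
  exact ⟨e, by simp [he, F], by simp [he, F]⟩

lemma P.exists_quot_cSub_algEquiv_R {α : k} (hf : f.eval α = 0) (hg : g.eval α ≠ 0) :
    ∃ e : QuotBy (P.cSub f g α) ≃ₐ[k] R (X : k[X]),
      e (cls (P.cSub f g α) (P.a f g)) = g.eval α • R.a X ∧
      e (cls (P.cSub f g α) (P.u f g)) = R.c X := by
  let F : P f g →ₐ[k] R (X : k[X]) :=
    P.lift f g (g.eval α • R.a X) (algebraMap k _ α) (R.c X)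
      (by rw [aeval_algebraMap_eq, hf, map_zero, add_zero, Algebra.commutes])
      (Algebra.commutes _ _).symm
      (by rw [aeval_algebraMap_eq, smul_mul_assoc, R.a_mul_c, aeval_X, smul_add, mul_smul_comm,
        Algebra.smul_def _ (R.c X)])
  let G : R (X : k[X]) →ₐ[k] QuotBy (P.cSub f g α) :=
    -- Dividing `a` by `g(α)` normalises the relation to `a u = u a + u`.
    R.lift X ((g.eval α)⁻¹ • clsHom k _ (P.a f g)) (clsHom k _ (P.u f g))
      (by rw [smul_mul_assoc, P.clsHom_a_mul_u, smul_add, mul_smul_comm, inv_smul_smul₀ hg, aeval_X])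
  obtain ⟨e, he⟩ := exists_quotBy_algEquiv F (by simp [F, P.cSub]) G
    (P.hom_ext (by simp [F, G, smul_smul, hg]) (by rw [P.clsHom_cSub_c]; simp [F])
      (by simp [F, G]))
    (fun F' hF' => R.hom_ext
      (by
        rw [AlgHom.comp_apply, R.lift_a, map_smul, hF', P.lift_a, inv_smul_smul₀ hg]
        rfl)
      (by
        rw [AlgHom.comp_apply, R.lift_c, hF', P.lift_u]
        rfl))
  exact ⟨e, by simp [he, F], by simp [he, F]⟩

/-- Setting `u = β c` turns the relation of `a` with `u` into `β` times that of `a` with `c`,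
because `f = c g`; only the relation of `R_f` is left. -/
lemma P.exists_quot_uSub_algEquiv (hfg : f = X * g) (β : k) :
    ∃ e : QuotBy (P.uSub f g β) ≃ₐ[k] R f,
      e (cls (P.uSub f g β) (P.a f g)) = R.a f ∧ e (cls (P.uSub f g β) (P.c f g)) = R.c f := by
  let F : P f g →ₐ[k] R f :=
    P.lift f g (R.a f) (R.c f) (β • R.c f) (R.a_mul_c f) (by rw [smul_mul_assoc, mul_smul_comm])
      (by rw [mul_smul_comm, R.a_mul_c, aeval_of_eq_X_mul hfg, smul_add, smul_mul_assoc,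
        mul_smul_comm])
  let G : R f →ₐ[k] QuotBy (P.uSub f g β) :=
    R.lift f (clsHom k _ (P.a f g)) (clsHom k _ (P.c f g))
      (by rw [← map_mul, P.a_mul_c, map_add, map_mul, aeval_algHom_apply])
  obtain ⟨e, he⟩ := exists_quotBy_algEquiv F (by simp [F, P.uSub]) G
    (P.hom_ext (by simp [F, G]) (by simp [F, G]) (by rw [P.clsHom_uSub_u]; simp [F, G]))
    (fun F' hF' => R.hom_ext
      (by
        rw [AlgHom.comp_apply, R.lift_a, hF', P.lift_a]
        rfl)
      (by
        rw [AlgHom.comp_apply, R.lift_c, hF', P.lift_c]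
        rfl))
  exact ⟨e, by simp [he, F], by simp [he, F]⟩

end Quotients

/-! ### Normal elements contained in a nonzero prime ideal -/

section PrimeIdeals

/-- The Euler derivation `∑ Xᵢ ∂/∂Xᵢ`. -/
def euler (k σ : Type*) [Field k] [Fintype σ] :
    Derivation k (MvPolynomial σ k) (MvPolynomial σ k) :=
  ∑ i : σ, (MvPolynomial.X i : MvPolynomial σ k) • MvPolynomial.pderiv i

lemma euler_apply_of_isHomogeneous {k σ : Type*} [Field k] [Fintype σ] {q : MvPolynomial σ k}
    {n : ℕ} (hq : q.IsHomogeneous n) : euler k σ q = n • q := by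
  rw [← hq.sum_X_mul_pderiv]
  exact map_sum ((Pi.evalAddMonoidHom _ q).comp Derivation.coeFnAddMonoidHom) _ _

/-- In characteristic zero, a subspace that is stable under the Euler derivation contains the
homogeneous components of its elements. -/
lemma mem_of_sum_mem_of_euler_mem {k σ : Type*} [Field k] [CharZero k] [Fintype σ]
    (J : Submodule k (MvPolynomial σ k)) (hJ : ∀ q ∈ J, euler k σ q ∈ J) (s : Finset ℕ) :
    ∀ q : ℕ → MvPolynomial σ k, (∀ i, (q i).IsHomogeneous i) → ∑ i ∈ s, q i ∈ J →
      ∀ i ∈ s, q i ∈ J := by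
  induction s using Finset.induction_on with
  | empty => simp
  | insert m s hm ih =>
    intro q hq hs
    have hE : ∑ i ∈ s, ((i : k) - m) • q i ∈ J := by
      -- The operator `E - m` kills the component of degree `m` and multiplies the one of degree `i`
      -- by `i - m`, a nonzero scalar for `i ∈ s`.
      have h : euler k σ (∑ i ∈ insert m s, q i) - (m : k) • ∑ i ∈ insert m s, q i =
          ∑ i ∈ s, ((i : k) - m) • q i := by
        rw [map_sum, Finset.smul_sum, ← Finset.sum_sub_distrib, Finset.sum_insert hm,
          euler_apply_of_isHomogeneous (hq m), Nat.cast_smul_eq_nsmul, sub_self, zero_add]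
        refine Finset.sum_congr rfl fun i _ => ?_
        rw [euler_apply_of_isHomogeneous (hq i), sub_smul, Nat.cast_smul_eq_nsmul,
          Nat.cast_smul_eq_nsmul]
      exact h ▸ J.sub_mem (hJ _ hs) (J.smul_mem _ hs)
    have hmem : ∀ i ∈ s, q i ∈ J := fun i hi => by
      have hne : (i : k) - m ≠ 0 := by
        rw [sub_ne_zero, Nat.cast_injective.ne_iff]
        rintro rfl
        exact hm hi
      exact (J.smul_mem_iff hne).mp
        (ih (fun i => ((i : k) - m) • q i)
          (fun i => (MvPolynomial.homogeneousSubmodule σ k i).smul_mem _ (hq i)) hE i hi)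
    intro i hi
    rcases Finset.mem_insert.mp hi with rfl | hi
    · rw [Finset.sum_insert hm] at hs
      exact (J.add_mem_iff_left (J.sum_mem hmem)).mp hs
    · exact hmem i hi

variable {k : Type*} [Field k] {f g : k[X]}

/-- A binary form is the homogenization of a polynomial in one variable. -/
lemma exists_homogenize_eq {q : MvPolynomial (Fin 2) k} {n : ℕ} (hq : q.IsHomogeneous n) :
    ∃ p : k[X], p.natDegree ≤ n ∧ p.homogenize n = q := by
  -- Dehomogenise by `u ↦ X`, `c ↦ 1`.
  refine ⟨MvPolynomial.aeval ![X, 1] q, ?_, homogenize_eq_of_isHomogeneous hq rfl⟩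
  have h : ∀ i : Fin 2, (![X, 1] i : k[X]).natDegree ≤ 1 := fun i => by fin_cases i <;> simp
  exact (MvPolynomial.aeval_natDegree_le q hq.totalDegree_le _ h).trans_eq (mul_one n)

lemma P.derivation_eq_smul_euler (g : k[X]) (q : MvPolynomial (Fin 2) k) :
    P.derivation g q = aeval (MvPolynomial.X 1) g * euler k (Fin 2) q := by
  have h : P.derivation g =
      (aeval (MvPolynomial.X 1 : MvPolynomial (Fin 2) k) g) • euler k (Fin 2) := by
    refine MvPolynomial.derivation_ext fun i => ?_
    rw [MvPolynomial.mkDerivation_X, Derivation.smul_apply,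
      euler_apply_of_isHomogeneous (MvPolynomial.isHomogeneous_X k i), one_smul, smul_eq_mul]
  rw [h]
  rfl

lemma P.derivation_aeval (g p : k[X]) : P.derivation g (aeval (MvPolynomial.X 1) p) =
    aeval (MvPolynomial.X 1) (X * g * derivative p) := by
  rw [Derivation.map_aeval, MvPolynomial.mkDerivation_X, smul_eq_mul, map_mul, map_mul, aeval_X]
  ring

lemma P.derivation_linear (g : k[X]) (β : k) :
    P.derivation g (MvPolynomial.X 0 - β • MvPolynomial.X 1) =
      aeval (MvPolynomial.X 1) g * (MvPolynomial.X 0 - β • MvPolynomial.X 1) := by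
  rw [map_sub, Derivation.map_smul, MvPolynomial.mkDerivation_X, MvPolynomial.mkDerivation_X,
    mul_sub, mul_smul_comm]

lemma P.incl_aeval (p : k[X]) :
    P.incl f g (aeval (MvPolynomial.X 1) p) = aeval (P.c f g) p := by
  rw [← aeval_algHom_apply, P.incl_X_one]

lemma P.incl_cSub (α : k) :
    P.incl f g (aeval (MvPolynomial.X 1) (X - C α)) = P.cSub f g α := by
  rw [P.incl_aeval, map_sub, aeval_X, aeval_C, P.cSub]

lemma P.incl_uSub (β : k) :
    P.incl f g (MvPolynomial.X 0 - β • MvPolynomial.X 1) = P.uSub f g β := by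
  rw [map_sub, map_smul, P.incl_X_zero, P.incl_X_one, P.uSub]

/-- The derivation sends `c - α` to `f(c)`, which is divisible by `c - α` at a root `α`; so `c - α`
is normal. -/
lemma P.exists_derivation_cSub {α : k} (hfg : f = X * g) (hα : f.eval α = 0) :
    ∃ s, P.derivation g (aeval (MvPolynomial.X 1) (X - C α)) =
      s * aeval (MvPolynomial.X 1) (X - C α) := by
  obtain ⟨q, hq⟩ := dvd_iff_isRoot.mpr hα
  refine ⟨aeval (MvPolynomial.X 1) q, ?_⟩
  rw [P.derivation_aeval, ← hfg, derivative_X_sub_C, mul_one, hq, map_mul, mul_comm]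

lemma P.coe_span_cSub (hfg : f = X * g) {α : k} (hα : f.eval α = 0) :
    (TwoSidedIdeal.span {P.cSub f g α} : Set (P f g)) =
      Set.range (fun p : P f g => P.cSub f g α * p) := by
  obtain ⟨s, hs⟩ := P.exists_derivation_cSub hfg hα
  simpa only [P.incl_cSub] using (P.isDiffOpRing hfg).coe_span_singleton hs

lemma P.coe_span_uSub (hfg : f = X * g) (β : k) :
    (TwoSidedIdeal.span {P.uSub f g β} : Set (P f g)) =
      Set.range (fun p : P f g => P.uSub f g β * p) := by
  simpa only [P.incl_uSub] using
    (P.isDiffOpRing hfg).coe_span_singleton (P.derivation_linear g β)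

lemma IsPrimeIdeal.one_notMem {B : Type*} [Ring B] {I : TwoSidedIdeal B} (hI : IsPrimeIdeal I) :
    (1 : B) ∉ I := fun h => hI.ne_top (eq_top_iff.mpr fun x _ => mul_one x ▸ I.mul_mem_left x 1 h)

lemma IsPrimeIdeal.algebraMap_notMem {B : Type*} [Ring B] [Algebra k B] {I : TwoSidedIdeal B}
    (hI : IsPrimeIdeal I) {α : k} (hα : α ≠ 0) : algebraMap k B α ∉ I := fun h => by
  refine hI.one_notMem ?_
  rw [← map_one (algebraMap k B), ← inv_mul_cancel₀ hα, map_mul]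
  exact I.mul_mem_left _ _ h

variable [IsAlgClosed k] {I : TwoSidedIdeal (P f g)}

/-- A prime ideal of `P(cg, g)` that contains a nonzero divisor of `f(c)` contains `c - α` for
some root `α` of `f`. -/
lemma P.exists_cSub_mem (hfg : f = X * g) (hI : IsPrimeIdeal I) (n : ℕ) :
    ∀ p : k[X], p ≠ 0 → p.natDegree = n → p ∣ f → aeval (P.c f g) p ∈ I →
      ∃ α : k, f.eval α = 0 ∧ P.cSub f g α ∈ I := by
  induction n with
  | zero =>
    intro p hp0 hp _ hpI
    rw [eq_C_of_natDegree_eq_zero hp] at hp0 hpI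
    rw [aeval_C] at hpI
    exact absurd hpI (hI.algebraMap_notMem (by simpa using hp0))
  | succ n ih =>
    intro p hp0 hp hpf hpI
    obtain ⟨α, hα⟩ := IsAlgClosed.exists_root p (fun h => by
      rw [natDegree_eq_of_degree_eq_some h] at hp
      exact absurd hp n.succ_ne_zero.symm)
    obtain ⟨q, rfl⟩ := dvd_iff_isRoot.mpr hα
    have hfα : f.eval α = 0 := dvd_iff_isRoot.mp ((dvd_mul_right _ _).trans hpf)
    obtain ⟨s, hs⟩ := P.exists_derivation_cSub hfg hfα
    rw [map_mul, ← P.incl_aeval (X - C α)] at hpI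
    rcases (P.isDiffOpRing hfg).mem_or_mem hI hs hpI with h | h
    · exact ⟨α, hfα, by rwa [P.incl_cSub] at h⟩
    · have hq0 : q ≠ 0 := right_ne_zero_of_mul hp0
      rw [natDegree_mul (X_sub_C_ne_zero α) hq0, natDegree_X_sub_C, add_comm] at hp
      exact ih q hq0 (Nat.succ_injective hp) ((dvd_mul_left _ _).trans hpf) h

/-- A prime ideal of `P(cg, g)` that contains a nonzero binary form in `u` and `c` contains `c` or
some `u - β c`. -/
lemma P.exists_linear_mem (hfg : f = X * g) (hI : IsPrimeIdeal I) (n : ℕ) :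
    ∀ (p : k[X]) (m : ℕ), p ≠ 0 → p.natDegree = n → n ≤ m →
      P.incl f g (p.homogenize m) ∈ I → P.c f g ∈ I ∨ ∃ β : k, P.uSub f g β ∈ I := by
  induction n with
  | zero =>
    intro p m hp0 hp _ hpI
    rw [eq_C_of_natDegree_eq_zero hp] at hp0 hpI
    rw [C_ne_zero] at hp0
    have hc : P.derivation g (MvPolynomial.X 1) =
        aeval (MvPolynomial.X 1) g * MvPolynomial.X 1 := MvPolynomial.mkDerivation_X ..
    -- A constant polynomial homogenises to a scalar times `c ^ m`, which primeness reduces to `c`.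
    rw [homogenize_C, map_mul, map_pow] at hpI
    left
    have hpow : P.incl f g (MvPolynomial.X 1) ^ m ∈ I := by
      have := I.mul_mem_left (P.incl f g (MvPolynomial.C (p.coeff 0)⁻¹)) _ hpI
      rwa [← mul_assoc, ← map_mul, ← MvPolynomial.C_mul, inv_mul_cancel₀ hp0, MvPolynomial.C_1,
        map_one, one_mul] at this
    rw [← P.incl_X_one f g]
    clear hpI
    induction m with
    | zero => exact absurd (by simpa using hpow) hI.one_notMem
    | succ m ihm =>
      rw [pow_succ'] at hpow
      exact ((P.isDiffOpRing hfg).mem_or_mem hI hc hpow).elim id (ihm (Nat.zero_le _))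
  | succ n ih =>
    intro p m hp0 hp hm hpI
    obtain ⟨β, hβ⟩ := IsAlgClosed.exists_root p (fun h => by
      rw [natDegree_eq_of_degree_eq_some h] at hp
      exact absurd hp n.succ_ne_zero.symm)
    obtain ⟨q, rfl⟩ := dvd_iff_isRoot.mpr hβ
    obtain ⟨m, rfl⟩ : ∃ l, m = 1 + l := ⟨m - 1, by omega⟩
    have hq0 : q ≠ 0 := right_ne_zero_of_mul hp0
    rw [natDegree_mul (X_sub_C_ne_zero β) hq0, natDegree_X_sub_C, add_comm] at hp
    have hq : q.natDegree = n := Nat.succ_injective hp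
    have hlin : (X - C β).homogenize 1 = MvPolynomial.X 0 - β • MvPolynomial.X 1 := by
      rw [homogenize_sub, homogenize_X one_ne_zero, homogenize_C, MvPolynomial.smul_eq_C_mul]
      simp
    rw [homogenize_mul _ _ (natDegree_X_sub_C_le β) (hq.le.trans (by omega)), hlin, map_mul] at hpI
    rcases (P.isDiffOpRing hfg).mem_or_mem hI (P.derivation_linear g β) hpI with h | h
    · exact .inr ⟨β, by rwa [P.incl_uSub] at h⟩
    · exact ih q m hq0 hq (by omega) h

/-- A nonzero prime ideal of `P(cg, g)` contains `c - α` for some root `α` of `f`, or some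
`u - β c`. -/
lemma P.exists_cSub_or_uSub_mem [CharZero k] (hfg : f = X * g) (hg : g ≠ 0) (hI : IsPrimeIdeal I)
    (hI0 : I ≠ ⊥) :
    (∃ α : k, f.eval α = 0 ∧ P.cSub f g α ∈ I) ∨ ∃ β : k, P.uSub f g β ∈ I := by
  by_cases hgI : aeval (P.c f g) g ∈ I
  · exact .inl (P.exists_cSub_mem hfg hI _ g hg rfl (hfg ▸ dvd_mul_left _ _) hgI)
  have H := P.isDiffOpRing hfg
  have : CharZero (MvPolynomial (Fin 2) k) :=
    charZero_of_injective_algebraMap (MvPolynomial.C_injective (Fin 2) k)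
  have hX1 : Function.Injective (aeval (R := k) (MvPolynomial.X 1 : MvPolynomial (Fin 2) k)) := by
    refine Function.LeftInverse.injective (g := MvPolynomial.aeval fun _ => X) fun p => ?_
    rw [← aeval_algHom_apply, MvPolynomial.aeval_X, aeval_X_left_apply]
  have hD : ∃ r, P.derivation g r ≠ 0 := by
    refine ⟨MvPolynomial.X 1, ?_⟩
    rw [MvPolynomial.mkDerivation_X]
    exact mul_ne_zero (fun h => hg (hX1 (by rw [h, map_zero]))) (MvPolynomial.X_ne_zero 1)
  obtain ⟨x, hx, hx0⟩ : ∃ x ∈ I, x ≠ 0 := by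
    by_contra! h
    exact hI0 (eq_bot_iff.mpr fun x hx => (TwoSidedIdeal.mem_bot _).mpr (h x hx))
  obtain ⟨q, hq0, hq⟩ := H.exists_mem_of_ne_zero hD I hx hx0
  -- So `g(c)` is normal and, lying outside `I`, can be cancelled from `g(c) E(r) ∈ I`. This makes
  -- the contraction of `I` stable under `E` itself.
  have hgD : P.derivation g (aeval (MvPolynomial.X 1) g) =
      aeval (MvPolynomial.X 1) (X * derivative g) * aeval (MvPolynomial.X 1) g := by
    rw [P.derivation_aeval, ← map_mul]
    congr 1
    ring
  let J : Submodule k (MvPolynomial (Fin 2) k) :=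
    ((TwoSidedIdeal.asIdeal I).restrictScalars k).comap (P.incl f g).toLinearMap
  have hJmem (r) : r ∈ J ↔ P.incl f g r ∈ I := TwoSidedIdeal.mem_asIdeal
  have hJ : ∀ r ∈ J, euler k (Fin 2) r ∈ J := fun r hr => by
    rw [hJmem] at hr ⊢
    have h := H.derivation_mem hr
    rw [P.derivation_eq_smul_euler, map_mul] at h
    exact (H.mem_or_mem hI hgD h).resolve_left (by rwa [P.incl_aeval])
  have hsum : ∑ i ∈ Finset.range (q.totalDegree + 1), MvPolynomial.homogeneousComponent i q ∈ J := by
    rwa [MvPolynomial.sum_homogeneousComponent, hJmem]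
  have hcomp := mem_of_sum_mem_of_euler_mem J hJ _ (fun i => MvPolynomial.homogeneousComponent i q)
    (fun i => MvPolynomial.homogeneousComponent_isHomogeneous i q) hsum
  obtain ⟨i, hi, hne⟩ : ∃ i ∈ Finset.range (q.totalDegree + 1),
      MvPolynomial.homogeneousComponent i q ≠ 0 := by
    by_contra! h
    exact hq0 (by rw [← MvPolynomial.sum_homogeneousComponent q, Finset.sum_eq_zero h])
  obtain ⟨p, hp, hpq⟩ := exists_homogenize_eq
    (MvPolynomial.homogeneousComponent_isHomogeneous i q)
  have hmem := hcomp i hi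
  rw [hJmem, ← hpq] at hmem
  have hp0 : p ≠ 0 := fun h => hne (by rw [← hpq, h, homogenize_zero])
  rcases P.exists_linear_mem hfg hI _ p i hp0 rfl hp hmem with h | h
  -- The factor `c` is `c - α` for the root `α = 0` of `f = c g`.
  · exact .inl ⟨0, by rw [hfg]; simp, by rwa [P.cSub, map_zero, sub_zero]⟩
  · exact .inr h

end PrimeIdeals

/-! ### Primality, incomparability and height one -/

section HeightOne

variable {k : Type*} [Field k]

/-- The quotient is a domain, so the ideal is even completely prime: the case `r = 1` of the
hypothesis suffices. -/
lemma isPrimeIdeal_span_of_algEquiv {B S : Type*} [Ring B] [Algebra k B] [Ring S] [IsDomain S]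
    [Algebra k S] {x : B} (e : QuotBy x ≃ₐ[k] S) : IsPrimeIdeal (TwoSidedIdeal.span {x}) where
  ne_top h := by
    have h1 : cls x 1 = 0 := cls_eq_zero_iff.mpr (h ▸ trivial)
    exact one_ne_zero ((map_one e).symm.trans ((congrArg e h1).trans (map_zero e)))
  mem_or_mem r s h := by
    have h1 : clsHom k x r * clsHom k x s = 0 := by
      rw [← map_mul]
      exact cls_eq_zero_iff.mpr (by simpa using h 1)
    have h2 := congrArg e h1
    rw [map_mul, map_zero, mul_eq_zero, EmbeddingLike.map_eq_zero_iff (f := e),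
      EmbeddingLike.map_eq_zero_iff (f := e)] at h2
    exact h2.imp cls_eq_zero_iff.mp cls_eq_zero_iff.mp

lemma isPrimeIdeal_bot {B : Type*} [Ring B] [IsDomain B] : IsPrimeIdeal (⊥ : TwoSidedIdeal B) where
  ne_top h := one_ne_zero ((TwoSidedIdeal.mem_bot B).mp (h ▸ trivial : (1 : B) ∈ ⊥))
  mem_or_mem r s h := by
    simpa [TwoSidedIdeal.mem_bot] using h 1

/-- In a domain, let `s` be a set of nonzero elements that generate pairwise incomparable prime
ideals, such that each nonzero prime ideal contains one of them. Then the height one primes are the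
ideals generated by the elements of `s`. -/
lemma isHeightOnePrime_iff {B : Type*} [Ring B] [IsDomain B] {s : Set B}
    (h0 : ∀ x ∈ s, x ≠ 0) (hprime : ∀ x ∈ s, IsPrimeIdeal (TwoSidedIdeal.span {x}))
    (hinc : ∀ x ∈ s, ∀ y ∈ s, y ∈ TwoSidedIdeal.span {x} → x = y)
    (hex : ∀ I : TwoSidedIdeal B, IsPrimeIdeal I → I ≠ ⊥ → ∃ x ∈ s, x ∈ I)
    (I : TwoSidedIdeal B) : IsHeightOnePrime I ↔ ∃ x ∈ s, I = TwoSidedIdeal.span {x} := by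
  let o : PrimeIdeals B := ⟨⊥, isPrimeIdeal_bot⟩
  have ho (J : PrimeIdeals B) : o ≤ J := (bot_le : (⊥ : TwoSidedIdeal B) ≤ J.1)
  have hbot : ∀ x ∈ s, TwoSidedIdeal.span {x} ≠ ⊥ := fun x hx h =>
    h0 x hx ((TwoSidedIdeal.mem_bot B).mp (h ▸ mem_span_self x))
  have hle {J : TwoSidedIdeal B} {x : B} (h : x ∈ J) : TwoSidedIdeal.span {x} ≤ J :=
    TwoSidedIdeal.span_le.mpr (by rintro _ rfl; exact h)
  constructor
  · rintro ⟨hI, hh⟩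
    have hI0 : I ≠ ⊥ := by
      rintro rfl
      have : Order.height o = 0 := Order.height_eq_zero.mpr fun J _ => ho J
      exact zero_ne_one (this.symm.trans hh)
    obtain ⟨x, hx, hxI⟩ := hex I hI hI0
    refine ⟨x, hx, ?_⟩
    by_contra hne
    -- If `(x) ≠ I`, the chain `0 < (x) < I` makes the height exceed one.
    have h1 : o < ⟨_, hprime x hx⟩ := (bot_lt_iff_ne_bot.mpr (hbot x hx) : ⊥ < _)
    have h2 : (⟨_, hprime x hx⟩ : PrimeIdeals B) < ⟨I, hI⟩ :=
      ((hle hxI).lt_of_ne (Ne.symm hne) : _ < I)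
    exact (Order.one_lt_height_iff.mpr ⟨_, _, h1, h2⟩).ne' hh
  · rintro ⟨x, hx, rfl⟩
    refine ⟨hprime x hx, le_antisymm ?_ ?_⟩
    · refine not_lt.mp fun h => ?_
      obtain ⟨J, K, hKJ, hJ⟩ := Order.one_lt_height_iff.mp h
      have hJ0 : J.1 ≠ ⊥ := by
        rintro hJ0
        refine not_lt_of_ge (ho K) (hKJ.trans_eq (Subtype.ext hJ0))
      -- A nonzero prime `J` strictly inside `(x)` contains some `y ∈ s`; incomparability forces `y
      -- = x`, hence `(x) ≤ J`.
      obtain ⟨y, hy, hyJ⟩ := hex J.1 J.2 hJ0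
      obtain rfl := hinc x hx y hy (hJ.le hyJ)
      exact not_lt_of_ge (hle hyJ) hJ
    · rw [Order.one_le_iff_ne_zero, Order.height_ne_zero]
      intro hmin
      exact hbot x hx (le_bot_iff.mp (hmin (ho _)))

variable {f g : k[X]}

lemma P.isPrimeIdeal_span_cSub {α : k} (hα : f.eval α = 0) :
    IsPrimeIdeal (TwoSidedIdeal.span {P.cSub f g α}) := by
  by_cases hg : g.eval α = 0
  · obtain ⟨e, -⟩ := P.exists_quot_cSub_algEquiv_mvPolynomial hα hg
    exact isPrimeIdeal_span_of_algEquiv e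
  · obtain ⟨e, -⟩ := P.exists_quot_cSub_algEquiv_R hα hg
    exact isPrimeIdeal_span_of_algEquiv e

lemma P.isPrimeIdeal_span_uSub (hfg : f = X * g) (β : k) :
    IsPrimeIdeal (TwoSidedIdeal.span {P.uSub f g β}) := by
  obtain ⟨e, -⟩ := P.exists_quot_uSub_algEquiv hfg β
  exact isPrimeIdeal_span_of_algEquiv e

lemma P.eq_of_cSub_mem_span_cSub {α α' : k} (hα : f.eval α = 0)
    (h : P.cSub f g α' ∈ TwoSidedIdeal.span {P.cSub f g α}) : α = α' := by
  by_contra hne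
  have h1 := TwoSidedIdeal.sub_mem _ h (mem_span_self _)
  rw [P.cSub, P.cSub, sub_sub_sub_cancel_left, ← map_sub] at h1
  exact (P.isPrimeIdeal_span_cSub hα).algebraMap_notMem (sub_ne_zero.mpr hne) h1

/-- Otherwise `u` would become the scalar `β α` modulo `c - α`, whereas there it is a variable, or
the generator `c` of `R_c`. -/
lemma P.uSub_notMem_span_cSub {α : k} (hα : f.eval α = 0) (β : k) :
    P.uSub f g β ∉ TwoSidedIdeal.span {P.cSub f g α} := by
  intro h
  have h1 : clsHom k (P.cSub f g α) (P.uSub f g β) = 0 := cls_eq_zero_iff.mpr h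
  have h2 : clsHom k (P.cSub f g α) (P.u f g) =
      algebraMap k (QuotBy (P.cSub f g α)) (β * α) := by
    rwa [P.uSub, map_sub, map_smul, P.clsHom_cSub_c, sub_eq_zero, Algebra.smul_def,
      ← map_mul] at h1
  by_cases hg : g.eval α = 0
  · obtain ⟨e, -, he⟩ := P.exists_quot_cSub_algEquiv_mvPolynomial hα hg
    have h3 := he.symm.trans ((congrArg e h2).trans (e.commutes _))
    -- Any point other than `β α` separates the variable from that constant.
    have h4 := congrArg (MvPolynomial.eval fun _ => β * α + 1) h3
    simp at h4
  · obtain ⟨e, -, he⟩ := P.exists_quot_cSub_algEquiv_R hα hg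
    have h3 := he.symm.trans ((congrArg e h2).trans (e.commutes _))
    refine X_ne_C (β * α) (R.aeval_c_injective X ?_)
    rwa [aeval_X, aeval_C]

/-- The quotient is `R_f`, in which `c` is transcendental over `k`. -/
lemma P.aeval_c_notMem_span_uSub (hfg : f = X * g) (β : k) {p : k[X]} (hp : p ≠ 0) :
    aeval (P.c f g) p ∉ TwoSidedIdeal.span {P.uSub f g β} := by
  intro h
  have h1 : clsHom k (P.uSub f g β) (aeval (P.c f g) p) = 0 := cls_eq_zero_iff.mpr h
  obtain ⟨e, -, he⟩ := P.exists_quot_uSub_algEquiv hfg β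
  have h2 := congrArg e h1
  rw [← aeval_algHom_apply, map_zero, ← AlgEquiv.coe_toAlgHom, ← aeval_algHom_apply] at h2
  refine hp (R.aeval_c_injective f ?_)
  rw [map_zero, ← h2]
  exact congrArg (fun y => aeval y p) he.symm

lemma P.cSub_notMem_span_uSub (hfg : f = X * g) (α β : k) :
    P.cSub f g α ∉ TwoSidedIdeal.span {P.uSub f g β} := by
  rw [← P.incl_cSub, P.incl_aeval]
  exact P.aeval_c_notMem_span_uSub hfg β (X_sub_C_ne_zero α)

lemma P.eq_of_uSub_mem_span_uSub (hfg : f = X * g) {β β' : k}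
    (h : P.uSub f g β' ∈ TwoSidedIdeal.span {P.uSub f g β}) : β = β' := by
  by_contra hne
  have h1 := TwoSidedIdeal.sub_mem _ h (mem_span_self _)
  -- The difference of the two elements is `(β - β') c`, a nonzero polynomial in `c`.
  rw [P.uSub, P.uSub, sub_sub_sub_cancel_left, ← sub_smul] at h1
  refine P.aeval_c_notMem_span_uSub hfg β (p := (β - β') • X)
    (smul_ne_zero (sub_ne_zero.mpr hne) X_ne_zero) ?_
  rwa [map_smul, aeval_X]

/-- The height one primes of `P(cg, g)`. -/
theorem P.isHeightOnePrime_iff [IsAlgClosed k] [CharZero k] (hfg : f = X * g) (hg : g ≠ 0)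
    (I : TwoSidedIdeal (P f g)) : IsHeightOnePrime I ↔
      (∃ α : k, f.eval α = 0 ∧ I = TwoSidedIdeal.span {P.cSub f g α}) ∨
      ∃ β : k, I = TwoSidedIdeal.span {P.uSub f g β} := by
  have := P.isDomain hfg
  let s : Set (P f g) :=
    {x | (∃ α : k, f.eval α = 0 ∧ x = P.cSub f g α) ∨ ∃ β : k, x = P.uSub f g β}
  have hinc : ∀ x ∈ s, ∀ y ∈ s, y ∈ TwoSidedIdeal.span {x} → x = y := by
    rintro _ (⟨α, hα, rfl⟩ | ⟨β, rfl⟩) _ (⟨α', hα', rfl⟩ | ⟨β', rfl⟩) h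
    · rw [P.eq_of_cSub_mem_span_cSub hα h]
    · exact absurd h (P.uSub_notMem_span_cSub hα β')
    · exact absurd h (P.cSub_notMem_span_uSub hfg α' β)
    · rw [P.eq_of_uSub_mem_span_uSub hfg h]
  have h0 : ∀ x ∈ s, x ≠ 0 := by
    rintro _ (⟨α, hα, rfl⟩ | ⟨β, rfl⟩) h
    · exact P.cSub_notMem_span_uSub hfg α 0 (h ▸ TwoSidedIdeal.zero_mem _)
    · exact P.uSub_notMem_span_cSub (α := 0) (by rw [hfg]; simp) β (h ▸ TwoSidedIdeal.zero_mem _)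
  rw [DiffOp.isHeightOnePrime_iff (s := s) h0 ?_ hinc ?_]
  · constructor
    · rintro ⟨_, ⟨α, hα, rfl⟩ | ⟨β, rfl⟩, rfl⟩
      · exact .inl ⟨α, hα, rfl⟩
      · exact .inr ⟨β, rfl⟩
    · rintro (⟨α, hα, rfl⟩ | ⟨β, rfl⟩)
      · exact ⟨_, .inl ⟨α, hα, rfl⟩, rfl⟩
      · exact ⟨_, .inr ⟨β, rfl⟩, rfl⟩
  · rintro _ (⟨α, hα, rfl⟩ | ⟨β, rfl⟩)
    · exact P.isPrimeIdeal_span_cSub hα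
    · exact P.isPrimeIdeal_span_uSub hfg β
  · intro J hJ hJ0
    rcases P.exists_cSub_or_uSub_mem hfg hg hJ hJ0 with ⟨α, hα, h⟩ | ⟨β, h⟩
    · exact ⟨_, .inl ⟨α, hα, rfl⟩, h⟩
    · exact ⟨_, .inr ⟨β, rfl⟩, h⟩

end HeightOne

end DiffOp

end

theorem mainTheorem12 {k : Type*} [Field k] [IsAlgClosed k] [CharZero k]
    (f g : Polynomial k) (hf : f ∉ Set.range Polynomial.C) (hfg : f = Polynomial.X * g) :
    -- the height one primes
    (∀ I : TwoSidedIdeal (DiffOp.P f g),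
      DiffOp.IsHeightOnePrime I ↔
        (∃ α : k, f.eval α = 0 ∧ I = TwoSidedIdeal.span {DiffOp.P.cSub f g α}) ∨
        (∃ β : k, I = TwoSidedIdeal.span {DiffOp.P.uSub f g β})) ∧
    -- the ideals `(x)` are the sets `x P`
    (∀ α : k, f.eval α = 0 →
      (TwoSidedIdeal.span {DiffOp.P.cSub f g α} : Set (DiffOp.P f g)) =
        Set.range (fun p : DiffOp.P f g => DiffOp.P.cSub f g α * p)) ∧
    (∀ β : k,
      (TwoSidedIdeal.span {DiffOp.P.uSub f g β} : Set (DiffOp.P f g)) =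
        Set.range (fun p : DiffOp.P f g => DiffOp.P.uSub f g β * p)) ∧
    -- `P / (c - α) ≅ k[a, u]` if `g(α) = 0`
    (∀ α : k, f.eval α = 0 → g.eval α = 0 →
      ∃ e : DiffOp.QuotBy (DiffOp.P.cSub f g α) ≃ₐ[k] MvPolynomial (Fin 2) k,
        e (DiffOp.cls (DiffOp.P.cSub f g α) (DiffOp.P.a f g)) = MvPolynomial.X 0 ∧
        e (DiffOp.cls (DiffOp.P.cSub f g α) (DiffOp.P.u f g)) = MvPolynomial.X 1) ∧
    -- `P / (c - α) ≅ R_c` (the enveloping algebra of the nonabelian plane) if `g(α) ≠ 0`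
    (∀ α : k, f.eval α = 0 → g.eval α ≠ 0 →
      ∃ e : DiffOp.QuotBy (DiffOp.P.cSub f g α) ≃ₐ[k] DiffOp.R (Polynomial.X : Polynomial k),
        e (DiffOp.cls (DiffOp.P.cSub f g α) (DiffOp.P.a f g)) =
          g.eval α • DiffOp.R.a Polynomial.X ∧
        e (DiffOp.cls (DiffOp.P.cSub f g α) (DiffOp.P.u f g)) = DiffOp.R.c Polynomial.X) ∧
    -- `P / (u - β c) ≅ R_f`
    (∀ β : k,
      ∃ e : DiffOp.QuotBy (DiffOp.P.uSub f g β) ≃ₐ[k] DiffOp.R f,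
        e (DiffOp.cls (DiffOp.P.uSub f g β) (DiffOp.P.a f g)) = DiffOp.R.a f ∧
        e (DiffOp.cls (DiffOp.P.uSub f g β) (DiffOp.P.c f g)) = DiffOp.R.c f) := by
  have hg : g ≠ 0 := by
    rintro rfl
    exact hf ⟨0, by rw [hfg, mul_zero, Polynomial.C_0]⟩
  exact ⟨DiffOp.P.isHeightOnePrime_iff hfg hg, fun _ => DiffOp.P.coe_span_cSub hfg,
    DiffOp.P.coe_span_uSub hfg, fun _ => DiffOp.P.exists_quot_cSub_algEquiv_mvPolynomial,
    fun _ => DiffOp.P.exists_quot_cSub_algEquiv_R, DiffOp.P.exists_quot_uSub_algEquiv hfg⟩
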